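/- Let $f_1,\dots,f_p$ be smooth vector fields on $\mathbb R^d$ vanishing at the origin, and let $V:\mathbb R^d\to\mathbb R_+$ be a smooth common weak Lyapunov function, i.e. $V(0)=0$, $V(x)>0$ for $x\neq0$, and $L_{f_i}V(x)=DV(x)\cdot f_i(x)\le 0$ for all $x\in\mathbb R^d$ and $i=1,\dots,p$. An input is a right-continuous piecewise constant function $u:[0,+\infty)\to\{1,\dots,p\}$ (finitely many switches on every bounded interval); $\Phi_u(\cdot,x)$ denotes the solution of $\dot x=f_{u(t)}(x)$ starting at $x$ at time $0$, and $$J_u=\{i:\ m\{t\ge 0:\ u(t)=i\}=+\infty\},$$ where $m$ is the Lebesgue measure. Let $K_i=\ker D^2L_{f_i}V(0)=\{y\in\mathbb R^d:\ D^2L_{f_i}V(0)[y,y]=0\}$, which is a linear subspace of $\mathbb R^d$. Let $J\subseteq\{1,\dots,p\}$ be nonempty with $\bigcap_{i\in J}K_i=\{0\}$, and suppose that one of the following conditions holds: 1. there exists $i\in J$ such that $\dim K_i=0$; 2. there exists $i\in J$ such that $\dim K_i=1$ and, for each $j\in J$, $K_i\subseteq K_j$ implies $K_i=K_j$; 3.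 $\#J=2$; 4. $\#J>2$ and $\dim\big(\sum_{i\in J}K_i\big)>\sum_{i\in J}\dim K_i-\#J+1$. Then the switched system is asymptotically stable at the origin for all inputs $u$ with $J_u=J$, that is: * (uniform stability) for every $\delta>0$ there is $\varepsilon>0$ such that for all $x$ with $\|x\|\le\varepsilon$ and all inputs $u$, $\Phi_u(t,x)$ is defined and $\|\Phi_u(t,x)\|\le\delta$ for all $t\ge0$; * (local attractivity) there is $\delta>0$ such that for all $x$ with $\|x\|\le\delta$ and all inputs $u$ with $J_u=J$, $\Phi_u(t,x)$ is defined for all $t\ge 0$ and tends to $0$ as $t\to+\infty$. -/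

import Mathlib

open Set Filter Topology MeasureTheory
open scoped ContDiff

noncomputable section

namespace SwitchedSystem

/-- The state space `ℝ^d` with its Euclidean norm. -/
abbrev State (d : ℕ) : Type := EuclideanSpace ℝ (Fin d)

/-- `u` restricted to `[0, ∞)` is an input (switching signal): there are switching times
`0 = a 0 < a 1 < ...` increasing to `+∞` such that `u` is constant on each `[a n, a (n+1))`.
The values of `u` at negative times play no role. -/
def IsInput {p : ℕ} (u : ℝ → Fin p) : Prop :=
  ∃ a : ℕ → ℝ, a 0 = 0 ∧ StrictMono a ∧ Tendsto a atTop atTop ∧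
    ∀ n, ∀ t ∈ Ico (a n) (a (n + 1)), u t = u (a n)

/-- The set `J_u` of the indices that `u` takes on a set of times of infinite Lebesgue measure. -/
def infiniteIndices {p : ℕ} (u : ℝ → Fin p) : Set (Fin p) :=
  {i | volume {t : ℝ | 0 ≤ t ∧ u t = i} = ⊤}

/-- `φ`, restricted to `[0, ∞)`, is the solution of `x' = f_{u(t)}(x)` with `φ 0 = x`. The input being
right-continuous and piecewise constant, this is a continuous function whose right derivative at
every time `t ≥ 0` is `f_{u(t)}(φ t)`. -/
structure IsSolution {d p : ℕ} (f : Fin p → State d → State d) (u : ℝ → Fin p) (x : State d)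
    (φ : ℝ → State d) : Prop where
  initial : φ 0 = x
  continuousOn : ContinuousOn φ (Ici 0)
  hasDeriv : ∀ t, 0 ≤ t → HasDerivWithinAt φ (f (u t) (φ t)) (Ici t) t

/-- The switched system is uniformly stable at the origin (over all inputs): small initial
conditions give solutions that are defined for all `t ≥ 0` and stay small. -/
def UniformlyStable {d p : ℕ} (f : Fin p → State d → State d) : Prop :=
  ∀ δ : ℝ, 0 < δ → ∃ ε : ℝ, 0 < ε ∧ ∀ x : State d, ‖x‖ ≤ ε → ∀ u, IsInput u →
    (∃ φ, IsSolution f u x φ) ∧ ∀ φ, IsSolution f u x φ → ∀ t, 0 ≤ t → ‖φ t‖ ≤ δ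

/-- The switched system is locally attractive at the origin for the inputs of the class `U`. -/
def LocallyAttractiveFor {d p : ℕ} (f : Fin p → State d → State d) (U : Set (ℝ → Fin p)) : Prop :=
  ∃ δ : ℝ, 0 < δ ∧ ∀ x : State d, ‖x‖ ≤ δ → ∀ u ∈ U, IsInput u →
    (∃ φ, IsSolution f u x φ) ∧ ∀ φ, IsSolution f u x φ → Tendsto φ atTop (𝓝 0)

/-- The switched system is asymptotically stable at the origin for the inputs of the class `U`. -/
def AsymptoticallyStableFor {d p : ℕ} (f : Fin p → State d → State d)
    (U : Set (ℝ → Fin p)) : Prop :=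
  UniformlyStable f ∧ LocallyAttractiveFor f U

/-- The Lie derivative `L_g V` of the function `V` along the vector field `g`. -/
def lieDeriv {d : ℕ} (g : State d → State d) (V : State d → ℝ) (x : State d) : ℝ :=
  fderiv ℝ V x (g x)

/-- The standing assumptions: smooth vector fields vanishing at the origin which share the smooth
weak Lyapunov function `V`. -/
structure HasWeakLyapunov {d p : ℕ} (f : Fin p → State d → State d) (V : State d → ℝ) : Prop where
  smooth_field : ∀ i, ContDiff ℝ ∞ (f i)
  field_zero : ∀ i, f i 0 = 0
  smooth_V : ContDiff ℝ ∞ V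
  V_zero : V 0 = 0
  V_pos : ∀ x, x ≠ 0 → 0 < V x
  lie_nonpos : ∀ i x, lieDeriv (f i) V x ≤ 0

/-- The second differential of `L_g V` at the origin, as a bilinear form. -/
def hessLie {d : ℕ} (g : State d → State d) (V : State d → ℝ) : State d →L[ℝ] State d →L[ℝ] ℝ :=
  fderiv ℝ (fderiv ℝ (lieDeriv g V)) 0

namespace HasWeakLyapunov

variable {d p : ℕ} {f : Fin p → State d → State d} {V : State d → ℝ}

theorem contDiff_lieDeriv (h : HasWeakLyapunov f V) (i : Fin p) :
    ContDiff ℝ ∞ (lieDeriv (f i) V) :=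
  (h.smooth_V.fderiv_right (m := ∞) (by simp)).clm_apply (h.smooth_field i)

theorem hessLie_symm (h : HasWeakLyapunov f V) (i : Fin p) (x y : State d) :
    hessLie (f i) V x y = hessLie (f i) V y x := by
  have hs := h.contDiff_lieDeriv i
  exact (hs.contDiffAt.isSymmSndFDerivAt (x := 0)
    (by simpa using ENat.LEInfty.out)) x y

theorem hessLie_nonpos (h : HasWeakLyapunov f V) (i : Fin p) (y : State d) :
    hessLie (f i) V y y ≤ 0 := by
  have hs := h.contDiff_lieDeriv i
  set L := lieDeriv (f i) V with hL
  have hd : Differentiable ℝ L := hs.differentiable (by simp)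
  have hd2 : Differentiable ℝ (fderiv ℝ L) :=
    (hs.fderiv_right (m := ∞) (by simp)).differentiable (by simp)
  have hline : ∀ t : ℝ, HasDerivAt (fun t : ℝ => t • y) y t := fun t => by
    simpa using (hasDerivAt_id t).smul_const y
  have h1 : ∀ t : ℝ, HasDerivAt (fun t : ℝ => L (t • y)) (fderiv ℝ L (t • y) y) t := fun t =>
    HasFDerivAt.comp_hasDerivAt (f := fun t : ℝ => t • y) t (hd (t • y)).hasFDerivAt (hline t)
  have h1' : deriv (fun t : ℝ => L (t • y)) = fun t => fderiv ℝ L (t • y) y :=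
    funext fun t => (h1 t).deriv
  have h2 : HasDerivAt (fun t : ℝ => fderiv ℝ L (t • y) y) (hessLie (f i) V y y) 0 := by
    have h3 : HasDerivAt (fun t : ℝ => fderiv ℝ L (t • y)) (hessLie (f i) V y) 0 := by
      have h4 := HasFDerivAt.comp_hasDerivAt (f := fun t : ℝ => t • y) (0 : ℝ)
        (hd2 ((0 : ℝ) • y)).hasFDerivAt (hline 0)
      rw [zero_smul] at h4
      exact h4
    simpa using h3.clm_apply (hasDerivAt_const (0 : ℝ) y)
  have hL0 : L 0 = 0 := by simp [hL, lieDeriv, h.field_zero i]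
  by_contra! hpos
  have hmax : IsLocalMax (fun t : ℝ => L (t • y)) 0 :=
    Eventually.of_forall fun t => by simpa [hL0] using h.lie_nonpos i (t • y)
  have hmin : IsLocalMin (fun t : ℝ => L (t • y)) 0 :=
    isLocalMin_of_deriv_deriv_pos (by rw [h1', h2.deriv]; exact hpos) hmax.deriv_eq_zero
      (h1 0).continuousAt
  have hzero : (fun t : ℝ => L (t • y)) =ᶠ[𝓝 0] fun _ => L ((0 : ℝ) • y) := by
    filter_upwards [hmax, hmin] with t ha hb using le_antisymm ha hb
  have h5 := hzero.deriv.deriv_eq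
  rw [h1', h2.deriv] at h5
  simp at h5
  exact hpos.ne' h5

/-- `K_i = ker D²(L_{f_i} V)(0)`, the set of the `y` with `D²(L_{f_i} V)(0)[y, y] = 0`; this is a
linear subspace because `L_{f_i} V` has a maximum at the origin. -/
def kerHess (h : HasWeakLyapunov f V) (i : Fin p) : Submodule ℝ (State d) where
  carrier := {y | hessLie (f i) V y y = 0}
  zero_mem' := by simp
  smul_mem' := fun c y (hy : hessLie (f i) V y y = 0) => by simp [hy]
  add_mem' := fun {x y} (hx : hessLie (f i) V x x = 0) (hy : hessLie (f i) V y y = 0) => by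
    have ha := h.hessLie_nonpos i (x + y)
    have hb := h.hessLie_nonpos i (x - y)
    have hc := h.hessLie_symm i x y
    simp only [map_add, map_sub, _root_.add_apply,
      _root_.sub_apply] at ha hb
    simp only [mem_ofPred_eq, map_add, _root_.add_apply]
    linarith

end HasWeakLyapunov

end SwitchedSystem

end

namespace SwitchedSystem

/-! ### Functions with a right derivative -/

/-! `V` does not increase along solutions, which gives stability. For attractivity, suppose that a
solution `φ` in a small ball keeps `V ∘ φ ≥ r > 0`. The total decrease of `V ∘ φ` is finite, so
`L_{f_{u(t)}} V (φ t) ≤ -η` holds only for a finite time. Hence no `i ∈ J` has `L_{f_i} V (φ t) ≤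
-η` for all large `t`, and, as `φ` has bounded speed, `φ t` eventually lies in the union of the open
sets `{L_{f_i} V > -η}`, `i ∈ J` (`eventually_exists_lt_lieDeriv`).

Suppose that `J` splits into nonempty classes `C`, `D` with `K_i ∩ K_j = 0` across them. The Hessian
of `L_{f_i} V + L_{f_j} V` is then negative definite, so for small `η` the open sets of `C` do not
meet those of `D` where `V ≥ r` in the ball. A tail of the orbit is connected, so it stays in the
sets of one class; the Lie derivatives of the other class are then at most `-η` for all large times,
which is impossible (`tendsto_zero_of_separated`). A single `K_i = 0` is handled in the same way,
without connectedness.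

The rest is linear algebra: each of the four conditions gives a zero kernel or such a splitting. For
the fourth, a family whose intersection graph is connected loses at least one dimension per added
member (`exists_separated_of_finrank_iSup_gt`). -/

theorem antitoneOn_of_hasDerivWithinAt_right_nonpos {g g' : ℝ → ℝ} (hc : ContinuousOn g (Ici 0))
    (hd : ∀ t, 0 ≤ t → HasDerivWithinAt g (g' t) (Ici t) t) (hn : ∀ t, 0 ≤ t → g' t ≤ 0) :
    AntitoneOn g (Ici 0) := by
  intro a ha b _ hab
  have h := intervalIntegral.sub_le_integral_of_hasDeriv_right_of_le (g := g) (g' := g')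
    (φ := fun _ => 0) hab (hc.mono fun x hx => le_trans (mem_Ici.1 ha) hx.1)
    (fun x hx => (hd x (le_trans (mem_Ici.1 ha) hx.1.le)).mono Ioi_subset_Ici_self)
    integrableOn_zero (fun x hx => hn x (le_trans (mem_Ici.1 ha) hx.1.le))
  simp at h
  exact h

/-- A nonnegative function which decreases at rate at least `η` at all times of a set `E` can only
do so if `E` has finite measure. -/
theorem volume_lt_top_of_right_deriv_le {g g' : ℝ → ℝ} (hc : ContinuousOn g (Ici 0))
    (hd : ∀ t, 0 ≤ t → HasDerivWithinAt g (g' t) (Ici t) t) (hn : ∀ t, 0 ≤ t → g' t ≤ 0)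
    (hg : ∀ t, 0 ≤ t → 0 ≤ g t) {η : ℝ} (hη : 0 < η) :
    volume {t : ℝ | 0 ≤ t ∧ g' t ≤ -η} < ⊤ := by
  set E : Set ℝ := {t : ℝ | 0 ≤ t ∧ g' t ≤ -η} with hE
  -- Markov's inequality for `-g'`, whose integral over `(0, n]` is `g 0 - g n ≤ g 0`; the bound
  -- does not depend on `n`.
  have key : ∀ n : ℕ, volume (E ∩ Ioc 0 (n : ℝ)) ≤ ENNReal.ofReal (g 0) / ENNReal.ofReal η := by
    intro n
    have hn0 : (0 : ℝ) ≤ n := n.cast_nonneg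
    have hc' : ContinuousOn g (Icc 0 (n : ℝ)) := hc.mono fun x hx => hx.1
    have hd' : ∀ x ∈ Ioo (0 : ℝ) n, HasDerivWithinAt g (g' x) (Ioi x) x := fun x hx =>
      (hd x hx.1.le).mono Ioi_subset_Ici_self
    have hint : IntegrableOn (fun t => -g' t) (Ioc 0 (n : ℝ)) :=
      intervalIntegral.integrableOn_deriv_right_of_nonneg hc'.neg (fun x hx => (hd' x hx).neg)
        (fun x hx => neg_nonneg.2 (hn x hx.1.le))
    have hI : ∫ t in Ioc (0 : ℝ) n, -g' t = g 0 - g n := by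
      rw [← intervalIntegral.integral_of_le hn0,
        intervalIntegral.integral_eq_sub_of_hasDeriv_right_of_le hn0 hc'.neg
          (fun x hx => (hd' x hx).neg)
          ((intervalIntegrable_iff_integrableOn_Ioc_of_le hn0).2 hint)]
      simp; ring
    have hlint : ∫⁻ t in Ioc (0 : ℝ) n, ENNReal.ofReal (-g' t) ≤ ENNReal.ofReal (g 0) := by
      rw [← ofReal_integral_eq_lintegral_ofReal hint, hI]
      · exact ENNReal.ofReal_le_ofReal (by linarith [hg n hn0])
      · exact (ae_restrict_mem measurableSet_Ioc).mono fun x hx => neg_nonneg.2 (hn x hx.1.le)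
    rw [ENNReal.le_div_iff_mul_le (Or.inl (by simpa using hη)) (Or.inl ENNReal.ofReal_ne_top),
      mul_comm]
    refine le_trans (le_trans ?_ (mul_meas_ge_le_lintegral₀
      hint.aestronglyMeasurable.aemeasurable.ennreal_ofReal (ENNReal.ofReal η))) hlint
    refine mul_le_mul_right ?_ _
    rw [Measure.restrict_apply₀' measurableSet_Ioc.nullMeasurableSet]
    exact measure_mono fun x hx =>
      ⟨ENNReal.ofReal_le_ofReal (by linarith [hx.1.2]), hx.2⟩
  have hunion : E ⊆ {0} ∪ ⋃ n : ℕ, E ∩ Ioc 0 (n : ℝ) := by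
    intro t ht
    rcases ht.1.eq_or_lt with h0 | h0
    · exact Or.inl h0.symm
    · obtain ⟨n, hn⟩ := exists_nat_ge t
      exact Or.inr (mem_iUnion.2 ⟨n, ht, h0, hn⟩)
  have hmono : Monotone fun n : ℕ => E ∩ Ioc 0 (n : ℝ) := fun a b hab =>
    inter_subset_inter_right _ (Ioc_subset_Ioc_right (by exact_mod_cast hab))
  calc volume E ≤ volume ({0} : Set ℝ) + volume (⋃ n : ℕ, E ∩ Ioc 0 (n : ℝ)) :=
        (measure_mono hunion).trans (measure_union_le _ _)
    _ ≤ ENNReal.ofReal (g 0) / ENNReal.ofReal η := by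
        rw [hmono.measure_iUnion]
        simpa using key
    _ < ⊤ := ENNReal.div_lt_top ENNReal.ofReal_ne_top (by simpa using hη)

/-- Among windows of fixed length that start arbitrarily late, infinitely many disjoint ones can be
selected. -/
theorem volume_eq_top_of_frequently_Icc_subset {F : Set ℝ} {τ : ℝ} (hτ : 0 < τ)
    (h : ∃ᶠ t in atTop, Icc t (t + τ) ⊆ F) : volume F = ⊤ := by
  have key : ∀ n : ℕ, ∃ T : ℝ, n * ENNReal.ofReal τ ≤ volume (F ∩ Iio T) := by
    intro n
    induction n with
    | zero => exact ⟨0, by simp⟩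
    | succ n ih =>
      obtain ⟨T, hT⟩ := ih
      obtain ⟨t, ht, hF⟩ := (frequently_atTop.1 h) T
      refine ⟨t + τ + 1, ?_⟩
      rw [← measure_inter_add_sdiff (F ∩ Iio (t + τ + 1)) (measurableSet_Iio (a := T)),
        Nat.cast_succ, add_mul, one_mul]
      refine add_le_add (hT.trans (measure_mono fun x hx => ⟨⟨hx.1, ?_⟩, hx.2⟩)) ?_
      · have := mem_Iio.1 hx.2
        exact mem_Iio.2 (by linarith)
      · calc ENNReal.ofReal τ = volume (Icc t (t + τ)) := by simp
          _ ≤ volume ((F ∩ Iio (t + τ + 1)) \ Iio T) := measure_mono fun x hx =>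
              ⟨⟨hF hx, mem_Iio.2 (by linarith [hx.2])⟩,
                fun hx' => absurd (mem_Iio.1 hx') (by linarith [hx.1])⟩
  by_contra hne
  obtain ⟨n, hn⟩ := ENNReal.exists_nat_mul_gt (a := ENNReal.ofReal τ) (by simpa using hτ) hne
  obtain ⟨T, hT⟩ := key n
  exact absurd (hn.trans_le (hT.trans (measure_mono inter_subset_left))) (lt_irrefl _)

/-! ### Second order conditions at the origin -/

/-- A function with a critical point and a negative definite second derivative at the origin is
negative on a punctured neighbourhood of the origin. -/
theorem exists_forall_neg_of_hessian_neg {d : ℕ} {G : State d → ℝ} (hG : ContDiff ℝ ∞ G)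
    (h0 : G 0 = 0) (h1 : fderiv ℝ G 0 = 0)
    (h2 : ∀ y, y ≠ 0 → fderiv ℝ (fderiv ℝ G) 0 y y < 0) :
    ∃ ρ : ℝ, 0 < ρ ∧ ∀ x, ‖x‖ ≤ ρ → x ≠ 0 → G x < 0 := by
  have hd : Differentiable ℝ G := hG.differentiable (by simp)
  have hd2 : Differentiable ℝ (fderiv ℝ G) :=
    (hG.fderiv_right (m := ∞) (by simp)).differentiable (by simp)
  set B := fderiv ℝ (fderiv ℝ G) 0 with hB
  obtain ⟨c, hc, hcB⟩ : ∃ c : ℝ, 0 < c ∧ ∀ y, B y y ≤ -c * ‖y‖ ^ 2 := by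
    -- The constant `c` is minus the maximum of the form on the unit sphere, which is empty when `d
    -- = 0`.
    rcases (Metric.sphere (0 : State d) 1).eq_empty_or_nonempty with he | hne
    · refine ⟨1, one_pos, fun y => ?_⟩
      have hy : y = 0 := by
        by_contra hy
        have : (‖y‖⁻¹ • y) ∈ Metric.sphere (0 : State d) 1 := by
          simp [norm_smul, inv_mul_cancel₀ (norm_ne_zero_iff.2 hy)]
        rw [he] at this
        exact this
      simp [hy]
    · obtain ⟨z, hz, hmax⟩ := (isCompact_sphere (0 : State d) 1).exists_isMaxOn hne
        (f := fun y => B y y) (by fun_prop)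
      have hz0 : z ≠ 0 := by rintro rfl; simp at hz
      refine ⟨-(B z z), by linarith [h2 z hz0], fun y => ?_⟩
      rcases eq_or_ne y 0 with rfl | hy
      · simp
      have hy' := norm_ne_zero_iff.2 hy
      have hm : (‖y‖⁻¹ • y) ∈ Metric.sphere (0 : State d) 1 := by
        simp [norm_smul, inv_mul_cancel₀ hy']
      have h := hmax hm
      simp only [mem_ofPred_eq, map_smul, _root_.smul_apply, smul_eq_mul] at h
      have hp : 0 < ‖y‖ ^ 2 := by positivity
      calc B y y = ‖y‖⁻¹ * (‖y‖⁻¹ * B y y) * ‖y‖ ^ 2 := by field_simp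
        _ ≤ B z z * ‖y‖ ^ 2 := by gcongr
        _ = _ := by ring
  -- Near `0`, `DG(x)` differs from `B x` by at most `(c / 2) ‖x‖`, so the derivative of `s ↦ G (s •
  -- x)` is at most `-(c / 2) s ‖x‖²`.
  have hlo := (hd2 0).hasFDerivAt.isLittleO.def (half_pos hc)
  obtain ⟨ρ, hρ, hball⟩ := Metric.nhds_basis_closedBall.eventually_iff.1 hlo
  refine ⟨ρ, hρ, fun x hx hx0 => ?_⟩
  have hderiv : ∀ s : ℝ, HasDerivAt (fun s : ℝ => G (s • x)) (fderiv ℝ G (s • x) x) s := fun s =>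
    HasFDerivAt.comp_hasDerivAt (f := fun t : ℝ => t • x) s (hd (s • x)).hasFDerivAt
      (by simpa using (hasDerivAt_id s).smul_const x)
  have hanti : StrictAntiOn (fun s : ℝ => G (s • x)) (Icc 0 1) := by
    refine strictAntiOn_of_deriv_neg (convex_Icc 0 1)
      (fun s _ => (hderiv s).continuousAt.continuousWithinAt) fun s hs => ?_
    rw [interior_Icc] at hs
    rw [(hderiv s).deriv]
    have hsx : s • x ∈ Metric.closedBall (0 : State d) ρ := by
      rw [mem_closedBall_zero_iff, norm_smul, Real.norm_of_nonneg hs.1.le]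
      nlinarith [norm_nonneg x, hs.2]
    have hb := hball hsx
    rw [h1, sub_zero, sub_zero] at hb
    have hb' := (ContinuousLinearMap.le_opNorm (fderiv ℝ G (s • x) - B (s • x)) x).trans
      (mul_le_mul_of_nonneg_right hb (norm_nonneg x))
    rw [norm_smul, Real.norm_of_nonneg hs.1.le] at hb'
    have hb'' := (le_abs_self _).trans hb'
    simp only [_root_.sub_apply, map_smul, _root_.smul_apply, smul_eq_mul] at hb''
    have hp : 0 < ‖x‖ ^ 2 := by have := norm_pos_iff.2 hx0; positivity
    have hsB := mul_le_mul_of_nonneg_left (hcB x) hs.1.le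
    nlinarith [mul_pos (mul_pos hs.1 hc) hp]
  have := hanti (left_mem_Icc.2 zero_le_one) (right_mem_Icc.2 zero_le_one) zero_lt_one
  simpa [h0] using this

namespace HasWeakLyapunov

variable {d p : ℕ} {f : Fin p → State d → State d} {V : State d → ℝ}

theorem lieDeriv_zero (h : HasWeakLyapunov f V) (i : Fin p) : lieDeriv (f i) V 0 = 0 := by
  simp [lieDeriv, h.field_zero i]

theorem fderiv_lieDeriv_zero (h : HasWeakLyapunov f V) (i : Fin p) :
    fderiv ℝ (lieDeriv (f i) V) 0 = 0 :=
  IsLocalMax.fderiv_eq_zero (Eventually.of_forall fun x => by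
    rw [h.lieDeriv_zero i]; exact h.lie_nonpos i x)

/-- If `K_i ∩ K_j = 0`, then `L_{f_i} V` and `L_{f_j} V` have no common zero near the origin, except
the origin. -/
theorem exists_lieDeriv_add_neg (h : HasWeakLyapunov f V) {i j : Fin p}
    (hij : h.kerHess i ⊓ h.kerHess j = ⊥) :
    ∃ ρ : ℝ, 0 < ρ ∧ ∀ x, ‖x‖ ≤ ρ → x ≠ 0 → lieDeriv (f i) V x + lieDeriv (f j) V x < 0 := by
  have hsi := h.contDiff_lieDeriv i
  have hsj := h.contDiff_lieDeriv j
  have hdi : Differentiable ℝ (lieDeriv (f i) V) := hsi.differentiable (by simp)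
  have hdj : Differentiable ℝ (lieDeriv (f j) V) := hsj.differentiable (by simp)
  have hdi2 : Differentiable ℝ (fderiv ℝ (lieDeriv (f i) V)) :=
    (hsi.fderiv_right (m := ∞) (by simp)).differentiable (by simp)
  have hdj2 : Differentiable ℝ (fderiv ℝ (lieDeriv (f j) V)) :=
    (hsj.fderiv_right (m := ∞) (by simp)).differentiable (by simp)
  have hfd : fderiv ℝ (fun x => lieDeriv (f i) V x + lieDeriv (f j) V x) =
      fun x => fderiv ℝ (lieDeriv (f i) V) x + fderiv ℝ (lieDeriv (f j) V) x :=
    funext fun x => fderiv_fun_add (hdi x) (hdj x)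
  refine exists_forall_neg_of_hessian_neg (G := fun x => lieDeriv (f i) V x + lieDeriv (f j) V x)
    (hsi.add hsj) ?_ ?_ fun y hy => ?_
  · simp [h.lieDeriv_zero]
  · rw [hfd]; simp [h.fderiv_lieDeriv_zero]
  · rw [hfd, fderiv_fun_add (hdi2 0) (hdj2 0)]
    have ha := h.hessLie_nonpos i y
    have hb := h.hessLie_nonpos j y
    change hessLie (f i) V y y + hessLie (f j) V y y < 0
    refine lt_of_le_of_ne (by linarith) fun he => hy ?_
    have hmem : y ∈ h.kerHess i ⊓ h.kerHess j :=
      ⟨show hessLie (f i) V y y = 0 by linarith, show hessLie (f j) V y y = 0 by linarith⟩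
    rwa [hij, Submodule.mem_bot] at hmem

end HasWeakLyapunov

end SwitchedSystem

namespace SwitchedSystem

variable {d p : ℕ} {f : Fin p → State d → State d} {V : State d → ℝ}

/-! ### Existence of solutions -/

/-- The global bound `M` allows a Picard–Lindelöf ball of radius `M (b - a)`, so one application
covers all of `[a, b]`. -/
theorem exists_hasDerivWithinAt_Icc {g : State d → State d} {K : NNReal} (hK : LipschitzWith K g)
    {M : NNReal} (hM : ∀ x, ‖g x‖ ≤ M) {a b : ℝ} (hab : a ≤ b) (x : State d) :
    ∃ ψ : ℝ → State d, ψ a = x ∧ ∀ t ∈ Icc a b, HasDerivWithinAt ψ (g (ψ t)) (Icc a b) t := by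
  have hP : IsPicardLindelof (fun _ => g) (⟨a, left_mem_Icc.2 hab⟩ : Icc a b) x
      (M * ⟨b - a, sub_nonneg.2 hab⟩) 0 M K := by
    refine IsPicardLindelof.of_time_independent (fun y _ => hM y) hK.lipschitzOnWith ?_
    simp only [sub_self, hab, sub_nonneg, max_eq_left, NNReal.coe_zero, sub_zero]
    exact le_rfl
  exact hP.exists_eq_forall_mem_Icc_hasDerivWithinAt₀

theorem exists_isSolution_of_lipschitz (hK : ∀ i, ∃ K, LipschitzWith K (f i))
    (hM : ∀ i, ∃ M : NNReal, ∀ x, ‖f i x‖ ≤ M) {u : ℝ → Fin p} (hu : IsInput u) (x : State d) :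
    ∃ φ, IsSolution f u x φ := by
  obtain ⟨a, ha0, hmono, hlim, hua⟩ := hu
  have hstep : ∀ n x, ∃ ψ : ℝ → State d, ψ (a n) = x ∧ ∀ t ∈ Icc (a n) (a (n + 1)),
      HasDerivWithinAt ψ (f (u (a n)) (ψ t)) (Icc (a n) (a (n + 1))) t := fun n x => by
    obtain ⟨K, hK⟩ := hK (u (a n))
    obtain ⟨M, hM⟩ := hM (u (a n))
    exact exists_hasDerivWithinAt_Icc hK hM (hmono n.lt_succ_self).le x
  choose S hS0 hS using hstep
  -- `xs n` is the state at the switching time `a n`: each piece starts where the previous one ends.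
  let xs : ℕ → State d := fun n => Nat.rec x (fun k y => S k y (a (k + 1))) n
  have hxs : ∀ n, xs (n + 1) = S n (xs n) (a (n + 1)) := fun n => rfl
  have hex : ∀ t : ℝ, ∃ n, 0 ≤ t → t ∈ Ico (a n) (a (n + 1)) := by
    intro t
    by_cases ht : 0 ≤ t
    · have h := (hlim.eventually_gt_atTop t).exists
      classical
      obtain ⟨n, hn⟩ : ∃ n, Nat.find h = n + 1 := Nat.exists_eq_succ_of_ne_zero fun h0 => by
        have := Nat.find_spec h
        rw [h0, ha0] at this
        linarith
      refine ⟨n, fun _ => ⟨not_lt.1 (Nat.find_min h (m := n) (by omega)), ?_⟩⟩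
      have := Nat.find_spec h
      rwa [hn] at this
    · exact ⟨0, fun h => absurd h ht⟩
  choose N hN using hex
  have hpos : ∀ n, 0 ≤ a n := fun n => ha0 ▸ hmono.monotone n.zero_le
  have huniq : ∀ n t, t ∈ Ico (a n) (a (n + 1)) → N t = n := by
    intro n t ht
    have h := hN t ((hpos n).trans ht.1)
    have h1 := hmono.lt_iff_lt.1 (h.1.trans_lt ht.2)
    have h2 := hmono.lt_iff_lt.1 (ht.1.trans_lt h.2)
    omega
  let φ : ℝ → State d := fun t => S (N t) (xs (N t)) t
  -- The right endpoint is included because consecutive pieces agree there; this yields left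
  -- continuity at switching times.
  have hφ : ∀ n, EqOn φ (S n (xs n)) (Icc (a n) (a (n + 1))) := by
    intro n t ht
    rcases ht.2.eq_or_lt with he | hlt
    · have h1 : N t = n + 1 := huniq (n + 1) t ⟨he.ge, he ▸ hmono (n + 1).lt_succ_self⟩
      simp only [φ]
      rw [h1, he, hS0, hxs]
    · simp only [φ]
      rw [huniq n t ⟨ht.1, hlt⟩]
  have hφd : ∀ n, ∀ t ∈ Icc (a n) (a (n + 1)),
      HasDerivWithinAt φ (f (u (a n)) (φ t)) (Icc (a n) (a (n + 1))) t := by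
    intro n t ht
    rw [hφ n ht]
    exact (hS n (xs n) t ht).congr (hφ n) (hφ n ht)
  have hright : ∀ t, 0 ≤ t → HasDerivWithinAt φ (f (u t) (φ t)) (Ici t) t := by
    intro t ht
    have h := hN t ht
    rw [hua _ t h]
    exact (hφd (N t) t ⟨h.1, h.2.le⟩).mono_of_mem_nhdsWithin
      (mem_of_superset (Icc_mem_nhdsGE h.2) (Icc_subset_Icc_left h.1))
  refine ⟨φ, ?_, fun t ht => ?_, hright⟩
  · have h0 : (0 : ℝ) ∈ Icc (a 0) (a 1) := ⟨ha0.le, hpos 1⟩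
    rw [hφ 0 h0]
    have := hS0 0 (xs 0)
    rwa [ha0] at this
  · have hr := (hright t ht).continuousWithinAt
    rcases (mem_Ici.1 ht).eq_or_lt with h0 | h0
    · rwa [← h0] at hr ⊢
    · obtain ⟨n, hn⟩ : ∃ n, t ∈ Ioc (a n) (a (n + 1)) := by
        have h := hN t ht
        rcases h.1.eq_or_lt with he | hlt
        · obtain ⟨n, hn⟩ := Nat.exists_eq_succ_of_ne_zero (n := N t) fun h0' => by
            rw [h0', ha0] at he
            linarith
          rw [hn] at he
          exact ⟨n, he ▸ hmono n.lt_succ_self, he.ge⟩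
        · exact ⟨N t, hlt, h.2.le⟩
      have hl : ContinuousWithinAt φ (Iic t) t :=
        (hφd n t ⟨hn.1.le, hn.2⟩).continuousWithinAt.mono_of_mem_nhdsWithin
          (mem_of_superset (Icc_mem_nhdsLE hn.1) (Icc_subset_Icc_right hn.2))
      exact (continuousAt_iff_continuous_left_right.2 ⟨hl, hr⟩).continuousWithinAt

/-! ### The Lyapunov function along solutions -/

namespace IsSolution

variable {u : ℝ → Fin p} {x : State d} {φ : ℝ → State d}

theorem hasDerivWithinAt_comp (hφ : IsSolution f u x φ) {W : State d → ℝ}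
    (hW : Differentiable ℝ W) {t : ℝ} (ht : 0 ≤ t) :
    HasDerivWithinAt (fun t => W (φ t)) (lieDeriv (f (u t)) W (φ t)) (Ici t) t :=
  (hW (φ t)).hasFDerivAt.comp_hasDerivWithinAt t (hφ.hasDeriv t ht)

theorem antitoneOn (hφ : IsSolution f u x φ) (h : HasWeakLyapunov f V) :
    AntitoneOn (fun t => V (φ t)) (Ici 0) :=
  antitoneOn_of_hasDerivWithinAt_right_nonpos
    (h.smooth_V.continuous.comp_continuousOn hφ.continuousOn)
    (fun _ ht => hφ.hasDerivWithinAt_comp (h.smooth_V.differentiable (by simp)) ht)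
    (fun t _ => h.lie_nonpos (u t) (φ t))

end IsSolution

namespace HasWeakLyapunov

theorem nonneg (h : HasWeakLyapunov f V) (x : State d) : 0 ≤ V x := by
  rcases eq_or_ne x 0 with rfl | hx
  · exact h.V_zero.ge
  · exact (h.V_pos x hx).le

theorem exists_pos_le_of_norm (h : HasWeakLyapunov f V) {r : ℝ} (hr : 0 < r) (R : ℝ) :
    ∃ m : ℝ, 0 < m ∧ ∀ x, r ≤ ‖x‖ → ‖x‖ ≤ R → m ≤ V x := by
  have hc : IsCompact (Metric.closedBall (0 : State d) R ∩ {x | r ≤ ‖x‖}) :=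
    (isCompact_closedBall 0 R).inter_right (isClosed_le continuous_const continuous_norm)
  rcases (Metric.closedBall (0 : State d) R ∩ {x | r ≤ ‖x‖}).eq_empty_or_nonempty with he | hne
  · refine ⟨1, one_pos, fun x h1 h2 => ?_⟩
    have : x ∈ Metric.closedBall (0 : State d) R ∩ {x | r ≤ ‖x‖} :=
      ⟨mem_closedBall_zero_iff.2 h2, h1⟩
    rw [he] at this
    exact this.elim
  · obtain ⟨z, hz, hmin⟩ := hc.exists_isMinOn hne h.smooth_V.continuous.continuousOn
    refine ⟨V z, h.V_pos z fun hz0 => ?_, fun x h1 h2 => hmin ⟨mem_closedBall_zero_iff.2 h2, h1⟩⟩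
    have : r ≤ ‖z‖ := hz.2
    rw [hz0, norm_zero] at this
    linarith

/-- Solutions starting in a small ball, whose radius only depends on the Lyapunov function, stay in
a given ball. -/
theorem exists_forall_norm_le (h : HasWeakLyapunov f V) {δ : ℝ} (hδ : 0 < δ) :
    ∃ ε : ℝ, 0 < ε ∧ ∀ f' : Fin p → State d → State d, HasWeakLyapunov f' V →
      ∀ x : State d, ‖x‖ ≤ ε → ∀ u φ, IsSolution f' u x φ → ∀ t, 0 ≤ t → ‖φ t‖ ≤ δ := by
  obtain ⟨m, hm, hmV⟩ := h.exists_pos_le_of_norm hδ δ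
  have hev : ∀ᶠ x in 𝓝 (0 : State d), V x < m :=
    h.smooth_V.continuous.continuousAt.eventually_lt_const (by rwa [h.V_zero])
  obtain ⟨ε, hε, hball⟩ := Metric.nhds_basis_closedBall.eventually_iff.1 hev
  -- `ε` puts the initial value of `V` below its minimum `m` on the sphere of radius `δ`; the bound
  -- by `δ` starts the intermediate value argument.
  refine ⟨min ε δ, lt_min hε hδ, fun f' h' x hx u φ hφ t ht => ?_⟩
  by_contra! hlt
  have hcont : ContinuousOn (fun s => ‖φ s‖) (Icc 0 t) :=
    hφ.continuousOn.norm.mono fun s hs => hs.1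
  obtain ⟨s, hs, hsδ⟩ := intermediate_value_Icc ht hcont
    (show δ ∈ Icc ‖φ 0‖ ‖φ t‖ from ⟨by rw [hφ.initial]; exact hx.trans (min_le_right _ _), hlt.le⟩)
  have h1 := hmV (φ s) hsδ.ge hsδ.le
  have h2 := hφ.antitoneOn h' (mem_Ici.2 le_rfl) (mem_Ici.2 hs.1) hs.1
  have h3 : V x < m := hball (mem_closedBall_zero_iff.2 (hx.trans (min_le_left _ _)))
  simp only [hφ.initial] at h2
  linarith

/-- Multiplying the vector fields with a cutoff function. -/
theorem smul_bump (h : HasWeakLyapunov f V) (χ : ContDiffBump (0 : State d)) :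
    HasWeakLyapunov (fun i x => χ x • f i x) V where
  smooth_field i := χ.contDiff.smul (h.smooth_field i)
  field_zero i := by simp [h.field_zero i]
  smooth_V := h.smooth_V
  V_zero := h.V_zero
  V_pos := h.V_pos
  lie_nonpos i x := by
    simp only [lieDeriv, map_smul, smul_eq_mul]
    exact mul_nonpos_of_nonneg_of_nonpos χ.nonneg (h.lie_nonpos i x)

/-- The fields may be incomplete, so existence is proved for fields cut off outside the `δ`-ball.
They share the Lyapunov function `V`, so the solution stays where the cutoff is `1` and solves the
original system. -/
theorem uniformlyStable (h : HasWeakLyapunov f V) : UniformlyStable f := by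
  intro δ hδ
  obtain ⟨ε, hε, H⟩ := h.exists_forall_norm_le hδ
  refine ⟨ε, hε, fun x hx u hu => ⟨?_, fun φ hφ => H f h x hx u φ hφ⟩⟩
  let χ : ContDiffBump (0 : State d) := ⟨δ, δ + 1, hδ, by linarith⟩
  have h' := h.smul_bump χ
  have hcs : ∀ i, HasCompactSupport fun x => χ x • f i x := fun i => χ.hasCompactSupport.smul_right
  obtain ⟨φ, hφ⟩ := exists_isSolution_of_lipschitz (f := fun i x => χ x • f i x)
    (fun i => (h'.smooth_field i).lipschitzWith_of_hasCompactSupport (hcs i) (by simp))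
    (fun i => by
      obtain ⟨C, hC⟩ := (hcs i).exists_bound_of_continuous (h'.smooth_field i).continuous
      exact ⟨C.toNNReal, fun x => (hC x).trans (Real.le_coe_toNNReal C)⟩) hu x
  refine ⟨φ, hφ.initial, hφ.continuousOn, fun t ht => ?_⟩
  have hd := hφ.hasDeriv t ht
  have h1 : χ (φ t) = 1 :=
    χ.one_of_mem_closedBall (mem_closedBall_zero_iff.2 (H _ h' x hx u φ hφ t ht))
  simpa [h1] using hd

end HasWeakLyapunov

end SwitchedSystem

namespace SwitchedSystem

variable {d p : ℕ} {f : Fin p → State d → State d} {V : State d → ℝ}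

/-! ### Attractivity -/

namespace IsSolution

variable {u : ℝ → Fin p} {x : State d} {φ : ℝ → State d}

theorem volume_lieDeriv_le_lt_top (hφ : IsSolution f u x φ) (h : HasWeakLyapunov f V) {η : ℝ}
    (hη : 0 < η) : volume {t : ℝ | 0 ≤ t ∧ lieDeriv (f (u t)) V (φ t) ≤ -η} < ⊤ :=
  volume_lt_top_of_right_deriv_le (h.smooth_V.continuous.comp_continuousOn hφ.continuousOn)
    (fun _ ht => hφ.hasDerivWithinAt_comp (h.smooth_V.differentiable (by simp)) ht)
    (fun t _ => h.lie_nonpos (u t) (φ t)) (fun t _ => h.nonneg (φ t)) hη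

/-- Otherwise, up to a bounded set, the infinite active time of `i` would be time spent decreasing
`V` at rate at least `η`. -/
theorem not_eventually_lieDeriv_le (hφ : IsSolution f u x φ) (h : HasWeakLyapunov f V) {η : ℝ}
    (hη : 0 < η) {i : Fin p} (hi : i ∈ infiniteIndices u) :
    ¬ ∀ᶠ t in atTop, lieDeriv (f i) V (φ t) ≤ -η := by
  intro hev
  obtain ⟨T, hT⟩ := eventually_atTop.1 hev
  have hsub : {t : ℝ | 0 ≤ t ∧ u t = i} ⊆
      Icc 0 T ∪ {t : ℝ | 0 ≤ t ∧ lieDeriv (f (u t)) V (φ t) ≤ -η} := by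
    rintro t ⟨ht, rfl⟩
    rcases le_total t T with h1 | h1
    · exact Or.inl ⟨ht, h1⟩
    · exact Or.inr ⟨ht, hT t h1⟩
  exact (((measure_mono hsub).trans (measure_union_le _ _)).trans_lt (ENNReal.add_lt_top.2
    ⟨by simp, hφ.volume_lieDeriv_le_lt_top h hη⟩)).ne hi

theorem norm_sub_le (hφ : IsSolution f u x φ) {δ M : ℝ} (hδ : ∀ t, 0 ≤ t → ‖φ t‖ ≤ δ)
    (hM : ∀ i y, ‖y‖ ≤ δ → ‖f i y‖ ≤ M) {s t : ℝ} (hs : 0 ≤ s) (hst : s ≤ t) :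
    ‖φ t - φ s‖ ≤ M * (t - s) :=
  norm_image_sub_le_of_norm_deriv_right_le_segment
    (hφ.continuousOn.mono fun _ hr => hs.trans hr.1) (fun r hr => hφ.hasDeriv r (hs.trans hr.1))
    (fun r hr => hM _ _ (hδ r (hs.trans hr.1))) t ⟨hst, le_rfl⟩

/-- A bounded solution eventually stays close to the union of the zero sets of the Lie derivatives
along the vector fields that are active for an infinite time. -/
theorem eventually_exists_lt_lieDeriv (hφ : IsSolution f u x φ) (h : HasWeakLyapunov f V) {δ : ℝ}
    (hδ : ∀ t, 0 ≤ t → ‖φ t‖ ≤ δ) {η : ℝ} (hη : 0 < η) :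
    ∀ᶠ t in atTop, ∃ i ∈ infiniteIndices u, -η < lieDeriv (f i) V (φ t) := by
  by_contra hne
  have hB : IsCompact (Metric.closedBall (0 : State d) δ) := isCompact_closedBall 0 δ
  obtain ⟨M, hM⟩ : ∃ M : ℝ, ∀ i y, ‖y‖ ≤ δ → ‖f i y‖ ≤ M := by
    obtain ⟨M, hM⟩ := hB.exists_bound_of_continuousOn (f := fun y i => f i y)
      (continuous_pi fun i => (h.smooth_field i).continuous).continuousOn
    exact ⟨M, fun i y hy =>
      (norm_le_pi_norm (fun i => f i y) i).trans (hM y (mem_closedBall_zero_iff.2 hy))⟩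
  have huc : UniformContinuousOn (fun y i => lieDeriv (f i) V y)
      (Metric.closedBall (0 : State d) δ) :=
    hB.uniformContinuousOn_of_continuous
      (continuous_pi fun i => (h.contDiff_lieDeriv i).continuous).continuousOn
  obtain ⟨ρ, hρ, hρη⟩ := Metric.uniformContinuousOn_iff.1 huc (η / 2) (half_pos hη)
  -- At speed at most `M`, less than `ρ` is travelled in time `τ`, so each Lie derivative changes by
  -- less than `η / 2`. Every bad time thus opens a window of length `τ` inside `F`.
  set τ : ℝ := ρ / (|M| + 1) with hτ
  have hM1 : 0 < |M| + 1 := by positivity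
  have hτ0 : 0 < τ := by positivity
  set F : Set ℝ := {t | 0 ≤ t ∧ ∀ i ∈ infiniteIndices u, lieDeriv (f i) V (φ t) ≤ -(η / 2)}
  have htop : volume F = ⊤ := by
    refine volume_eq_top_of_frequently_Icc_subset hτ0 ?_
    refine ((not_eventually.1 hne).and_eventually (eventually_ge_atTop 0)).mono ?_
    rintro t ⟨hlt, ht⟩ s hs
    refine ⟨ht.trans hs.1, fun i hi => ?_⟩
    have hs0 := ht.trans hs.1
    have hdist : dist (φ s) (φ t) < ρ := by
      rw [dist_eq_norm]
      calc ‖φ s - φ t‖ ≤ M * (s - t) := hφ.norm_sub_le hδ hM ht hs.1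
        _ ≤ |M| * τ := mul_le_mul (le_abs_self M) (by linarith [hs.2]) (by linarith [hs.1])
            (abs_nonneg M)
        _ < (|M| + 1) * τ := by linarith
        _ = ρ := mul_div_cancel₀ ρ hM1.ne'
    have h1 := hρη (φ s) (mem_closedBall_zero_iff.2 (hδ s hs0)) (φ t)
      (mem_closedBall_zero_iff.2 (hδ t ht)) hdist
    have h2 := (dist_le_pi_dist (fun i => lieDeriv (f i) V (φ s))
      (fun i => lieDeriv (f i) V (φ t)) i).trans_lt h1
    rw [Real.dist_eq] at h2
    have h3 := (abs_lt.1 h2).2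
    have h4 : lieDeriv (f i) V (φ t) ≤ -η := by
      by_contra! h4
      exact hlt ⟨i, hi, h4⟩
    linarith
  -- On `F`, either `V` decreases at rate at least `η / 2`, or an index of finite total active time
  -- is in use; both take finite time.
  have hsub : F ⊆ {t : ℝ | 0 ≤ t ∧ lieDeriv (f (u t)) V (φ t) ≤ -(η / 2)} ∪
      ⋃ i ∈ (infiniteIndices u)ᶜ, {t : ℝ | 0 ≤ t ∧ u t = i} := by
    intro t ht
    by_cases hi : u t ∈ infiniteIndices u
    · exact Or.inl ⟨ht.1, ht.2 _ hi⟩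
    · exact Or.inr (mem_biUnion (x := u t) hi ⟨ht.1, rfl⟩)
  have hfin : volume F < ⊤ := (measure_mono hsub).trans_lt <| measure_union_lt_top
    (hφ.volume_lieDeriv_le_lt_top h (half_pos hη))
    (measure_biUnion_lt_top (toFinite _) fun i hi => lt_top_iff_ne_top.2 hi)
  exact hfin.ne htop

/-- By monotonicity `V ∘ φ` remains small once it is small, and `V` is bounded below on shells `ε ≤
‖x‖ ≤ δ`. -/
theorem tendsto_zero_of_forall_eventually_lt (hφ : IsSolution f u x φ) (h : HasWeakLyapunov f V)
    {δ : ℝ} (hδ : ∀ t, 0 ≤ t → ‖φ t‖ ≤ δ)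
    (hV : ∀ r : ℝ, 0 < r → ∃ t, 0 ≤ t ∧ V (φ t) < r) : Tendsto φ atTop (𝓝 0) := by
  rw [Metric.tendsto_atTop]
  intro ε hε
  obtain ⟨m, hm, hmV⟩ := h.exists_pos_le_of_norm hε δ
  obtain ⟨T, hT, hlt⟩ := hV m hm
  refine ⟨T, fun t ht => ?_⟩
  rw [dist_zero_right]
  by_contra! hle
  have h1 := hmV (φ t) hle (hδ t (hT.trans ht))
  have h2 : V (φ t) ≤ V (φ T) := hφ.antitoneOn h (mem_Ici.2 hT) (mem_Ici.2 (hT.trans ht)) ht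
  linarith

end IsSolution

namespace HasWeakLyapunov

/-- Uniform negativity of the sum of two Lie derivatives away from the origin. -/
theorem exists_lieDeriv_add_le (h : HasWeakLyapunov f V) {δ : ℝ} {i j : Fin p}
    (hij : ∀ x, ‖x‖ ≤ δ → x ≠ 0 → lieDeriv (f i) V x + lieDeriv (f j) V x < 0)
    {r : ℝ} (hr : 0 < r) :
    ∃ η : ℝ, 0 < η ∧ ∀ x, ‖x‖ ≤ δ → r ≤ V x →
      lieDeriv (f i) V x + lieDeriv (f j) V x ≤ -η := by
  have hc : IsCompact (Metric.closedBall (0 : State d) δ ∩ {x | r ≤ V x}) :=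
    (isCompact_closedBall 0 δ).inter_right (isClosed_le continuous_const h.smooth_V.continuous)
  rcases (Metric.closedBall (0 : State d) δ ∩ {x | r ≤ V x}).eq_empty_or_nonempty with he | hne
  · refine ⟨1, one_pos, fun x h1 h2 => ?_⟩
    have : x ∈ Metric.closedBall (0 : State d) δ ∩ {x | r ≤ V x} :=
      ⟨mem_closedBall_zero_iff.2 h1, h2⟩
    rw [he] at this
    exact this.elim
  · obtain ⟨z, hz, hmax⟩ := hc.exists_isMaxOn hne
      ((h.contDiff_lieDeriv i).continuous.add (h.contDiff_lieDeriv j).continuous).continuousOn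
    have hz0 : z ≠ 0 := by
      rintro rfl
      have : r ≤ V 0 := hz.2
      rw [h.V_zero] at this
      linarith
    refine ⟨-(lieDeriv (f i) V z + lieDeriv (f j) V z),
      by linarith [hij z (mem_closedBall_zero_iff.1 hz.1) hz0], fun x h1 h2 => ?_⟩
    rw [neg_neg]
    exact hmax ⟨mem_closedBall_zero_iff.2 h1, h2⟩

/-- If the indices that are active for an infinite time split into two nonempty classes such that
`L_{f_i} V` and `L_{f_j} V` have no common zero but the origin when `i` and `j` are in different
classes, then bounded solutions converge to the origin. -/
theorem tendsto_zero_of_separated (h : HasWeakLyapunov f V) {δ : ℝ} {C D : Finset (Fin p)}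
    (hC : C.Nonempty) (hD : D.Nonempty)
    (hCD : ∀ i ∈ C, ∀ j ∈ D, ∀ x, ‖x‖ ≤ δ → x ≠ 0 →
      lieDeriv (f i) V x + lieDeriv (f j) V x < 0)
    {u : ℝ → Fin p} (hu : infiniteIndices u = (C : Set (Fin p)) ∪ D) {x : State d}
    {φ : ℝ → State d} (hφ : IsSolution f u x φ) (hδ : ∀ t, 0 ≤ t → ‖φ t‖ ≤ δ) :
    Tendsto φ atTop (𝓝 0) := by
  refine hφ.tendsto_zero_of_forall_eventually_lt h hδ fun r hr => ?_
  by_contra! hV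
  -- With `2 * η`, two Lie derivatives from different classes cannot both exceed `-η`; a single `η`
  -- serves the finitely many pairs.
  obtain ⟨η, hη, hsep⟩ : ∃ η : ℝ, 0 < η ∧ ∀ i ∈ C, ∀ j ∈ D, ∀ x, ‖x‖ ≤ δ → r ≤ V x →
      lieDeriv (f i) V x + lieDeriv (f j) V x ≤ -(2 * η) := by
    choose! η hη hη' using fun i (hi : i ∈ C) j (hj : j ∈ D) =>
      h.exists_lieDeriv_add_le (hCD i hi j hj) hr
    obtain ⟨q, hq, hmin⟩ := (C ×ˢ D).exists_min_image (fun q => η q.1 q.2) (hC.product hD)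
    rw [Finset.mem_product] at hq
    refine ⟨η q.1 q.2 / 2, half_pos (hη _ hq.1 _ hq.2), fun i hi j hj x h1 h2 => ?_⟩
    have h3 := hmin (i, j) (Finset.mem_product.2 ⟨hi, hj⟩)
    linarith [hη' i hi j hj x h1 h2]
  have hopen : ∀ S : Finset (Fin p), IsOpen {y | ∃ i ∈ S, -η < lieDeriv (f i) V y} := fun S => by
    have : {y | ∃ i ∈ S, -η < lieDeriv (f i) V y} = ⋃ i ∈ S, {y | -η < lieDeriv (f i) V y} := by
      ext; simp
    rw [this]
    exact isOpen_biUnion fun i _ =>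
      isOpen_lt continuous_const (h.contDiff_lieDeriv i).continuous
  obtain ⟨T, hT⟩ := eventually_atTop.1
    ((hφ.eventually_exists_lt_lieDeriv h hδ hη).and (eventually_ge_atTop 0))
  have hT0 : 0 ≤ T := (hT T le_rfl).2
  have hconn : IsPreconnected (φ '' Ici T) :=
    isPreconnected_Ici.image φ (hφ.continuousOn.mono (Ici_subset_Ici.2 hT0))
  have hstay : ∀ S S' : Finset (Fin p), S'.Nonempty →
      (∀ i ∈ S, ∀ j ∈ S', ∀ x, ‖x‖ ≤ δ → r ≤ V x →
        lieDeriv (f i) V x + lieDeriv (f j) V x ≤ -(2 * η)) →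
      (S' : Set (Fin p)) ⊆ infiniteIndices u →
      (∀ t, T ≤ t → ∃ i ∈ S, -η < lieDeriv (f i) V (φ t)) → False := by
    rintro S S' ⟨j, hj⟩ hSS hS' hS
    refine hφ.not_eventually_lieDeriv_le h hη (hS' hj) (eventually_atTop.2 ⟨T, fun t ht => ?_⟩)
    obtain ⟨i, hi, hlt⟩ := hS t ht
    linarith [hSS i hi j hj (φ t) (hδ t (hT0.trans ht)) (hV t (hT0.trans ht))]
  have hcover : ∀ t, T ≤ t → (∃ i ∈ C, -η < lieDeriv (f i) V (φ t)) ∨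
      ∃ i ∈ D, -η < lieDeriv (f i) V (φ t) := fun t ht => by
    obtain ⟨i, hi, hlt⟩ := (hT t ht).1
    rw [hu] at hi
    exact hi.imp (fun hi => ⟨i, hi, hlt⟩) fun hi => ⟨i, hi, hlt⟩
  by_cases hnC : ∀ t, T ≤ t → ∃ i ∈ C, -η < lieDeriv (f i) V (φ t)
  · exact hstay C D hD hsep (hu ▸ subset_union_right) hnC
  by_cases hnD : ∀ t, T ≤ t → ∃ i ∈ D, -η < lieDeriv (f i) V (φ t)
  · exact hstay D C hC (fun i hi j hj x h1 h2 => by linarith [hsep j hj i hi x h1 h2])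
      (hu ▸ subset_union_left) hnD
  push Not at hnC hnD
  obtain ⟨s, hs, hs'⟩ := hnC
  obtain ⟨t, ht, ht'⟩ := hnD
  -- Both open sets meet the connected tail of the orbit and together cover it, so they meet on it,
  -- against `hsep`.
  obtain ⟨_, ⟨q, hq, rfl⟩, ⟨i, hi, hi'⟩, ⟨j, hj, hj'⟩⟩ := hconn _ _ (hopen C) (hopen D)
    (by rintro _ ⟨q, hq, rfl⟩; exact hcover q hq)
    ⟨φ t, ⟨t, ht, rfl⟩, (hcover t ht).resolve_right fun ⟨i, hi, hlt⟩ =>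
      absurd hlt (ht' i hi).not_gt⟩
    ⟨φ s, ⟨s, hs, rfl⟩, (hcover s hs).resolve_left fun ⟨i, hi, hlt⟩ =>
      absurd hlt (hs' i hi).not_gt⟩
  have hq0 := hT0.trans (mem_Ici.1 hq)
  linarith [hsep i hi j hj (φ q) (hδ q hq0) (hV q hq0)]

/-- If `L_{f_i} V` is negative definite for some index `i` which is active for an infinite time, then
bounded solutions converge to the origin. -/
theorem tendsto_zero_of_lieDeriv_neg (h : HasWeakLyapunov f V) {δ : ℝ} {i : Fin p}
    (hi : ∀ x, ‖x‖ ≤ δ → x ≠ 0 → lieDeriv (f i) V x + lieDeriv (f i) V x < 0)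
    {u : ℝ → Fin p} (hu : i ∈ infiniteIndices u) {x : State d}
    {φ : ℝ → State d} (hφ : IsSolution f u x φ) (hδ : ∀ t, 0 ≤ t → ‖φ t‖ ≤ δ) :
    Tendsto φ atTop (𝓝 0) := by
  refine hφ.tendsto_zero_of_forall_eventually_lt h hδ fun r hr => ?_
  by_contra! hV
  obtain ⟨η, hη, hle⟩ := h.exists_lieDeriv_add_le hi hr
  refine hφ.not_eventually_lieDeriv_le h (half_pos hη) hu
    (eventually_atTop.2 ⟨0, fun t ht => ?_⟩)
  linarith [hle (φ t) (hδ t ht) (hV t ht)]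

theorem locallyAttractiveFor_of_bounded (h : HasWeakLyapunov f V) {U : Set (ℝ → Fin p)} {δ : ℝ}
    (hδ : 0 < δ)
    (hU : ∀ u ∈ U, ∀ x φ, IsSolution f u x φ → (∀ t, 0 ≤ t → ‖φ t‖ ≤ δ) →
      Tendsto φ atTop (𝓝 0)) : LocallyAttractiveFor f U := by
  obtain ⟨ε, hε, H⟩ := h.uniformlyStable δ hδ
  exact ⟨ε, hε, fun x hx u hu hin =>
    ⟨(H x hx u hin).1, fun φ hφ => hU u hu x φ hφ ((H x hx u hin).2 φ hφ)⟩⟩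

theorem locallyAttractiveFor_of_kerHess_eq_bot (h : HasWeakLyapunov f V) {i : Fin p}
    (hi : h.kerHess i = ⊥) : LocallyAttractiveFor f {u | i ∈ infiniteIndices u} := by
  obtain ⟨ρ, hρ, hneg⟩ := h.exists_lieDeriv_add_neg (i := i) (j := i) (by rw [hi, bot_inf_eq])
  exact h.locallyAttractiveFor_of_bounded hρ fun u hu x φ hφ hb =>
    h.tendsto_zero_of_lieDeriv_neg hneg hu hφ hb

theorem locallyAttractiveFor_of_separated (h : HasWeakLyapunov f V) {C D : Finset (Fin p)}
    (hC : C.Nonempty) (hD : D.Nonempty)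
    (hCD : ∀ i ∈ C, ∀ j ∈ D, h.kerHess i ⊓ h.kerHess j = ⊥) :
    LocallyAttractiveFor f {u | infiniteIndices u = (C : Set (Fin p)) ∪ D} := by
  choose! ρ hρ hneg using fun i (hi : i ∈ C) j (hj : j ∈ D) =>
    h.exists_lieDeriv_add_neg (hCD i hi j hj)
  obtain ⟨q, hq, hmin⟩ := (C ×ˢ D).exists_min_image (fun q => ρ q.1 q.2) (hC.product hD)
  rw [Finset.mem_product] at hq
  exact h.locallyAttractiveFor_of_bounded (hρ _ hq.1 _ hq.2) fun u hu x φ hφ hb =>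
    h.tendsto_zero_of_separated hC hD (fun i hi j hj y hy => hneg i hi j hj y
      (hy.trans (hmin (i, j) (Finset.mem_product.2 ⟨hi, hj⟩)))) hu hφ hb

end HasWeakLyapunov

/-! ### Families of subspaces -/

/-- If the dimension of the sum of a family of subspaces is larger than for a family whose
intersection graph is connected, then the family splits into two parts such that the members of
different parts are independent. -/
theorem exists_separated_of_finrank_iSup_gt {ι E : Type*} [AddCommGroup E] [Module ℝ E]
    [FiniteDimensional ℝ E] (K : ι → Submodule ℝ E) {J : Finset ι} (hJ : J.Nonempty)
    (hgt : (Module.finrank ℝ (⨆ i ∈ J, K i : Submodule ℝ E) : ℤ) >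
      (∑ i ∈ J, (Module.finrank ℝ (K i) : ℤ)) - (J.card : ℤ) + 1) :
    ∃ C ⊆ J, C.Nonempty ∧ (∃ j ∈ J, j ∉ C) ∧ ∀ i ∈ C, ∀ j ∈ J, j ∉ C → K i ⊓ K j = ⊥ := by
  classical
  by_contra! hcon
  -- If no splitting exists, the intersection graph is connected and `S` can be grown one index at a
  -- time: the new `K j` meets some `K i`, `i ∈ S`, nontrivially, so the sum gains at most `dim (K
  -- j) - 1`.
  have key : ∀ n : ℕ, n < J.card → ∃ S ⊆ J, S.card = n + 1 ∧
      (Module.finrank ℝ (⨆ i ∈ S, K i : Submodule ℝ E) : ℤ) ≤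
        (∑ i ∈ S, (Module.finrank ℝ (K i) : ℤ)) - (S.card : ℤ) + 1 := by
    intro n
    induction n with
    | zero =>
      intro _
      obtain ⟨i, hi⟩ := hJ
      exact ⟨{i}, by simpa using hi, by simp, by rw [Finset.iSup_singleton]; simp⟩
    | succ n ih =>
      intro hn
      obtain ⟨S, hSJ, hcard, hle⟩ := ih (by omega)
      obtain ⟨i, hi, j, hj, hjS, hij⟩ := hcon S hSJ (Finset.card_pos.1 (by omega)) (by
        by_contra! hall
        have := Finset.card_le_card (show J ⊆ S from hall)
        omega)
      refine ⟨insert j S, Finset.insert_subset hj hSJ, by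
        rw [Finset.card_insert_of_notMem hjS, hcard], ?_⟩
      have hdim := Submodule.finrank_sup_add_finrank_inf_eq (K j) (⨆ i ∈ S, K i)
      have hpos : 0 < Module.finrank ℝ (K j ⊓ ⨆ i ∈ S, K i : Submodule ℝ E) := by
        rw [pos_iff_ne_zero, Ne, Submodule.finrank_eq_zero]
        intro hbot
        refine hij (eq_bot_iff.2 (le_trans ?_ hbot.le))
        rw [inf_comm]
        exact inf_le_inf_left _ (le_biSup K hi)
      rw [Finset.iSup_insert, Finset.sum_insert hjS, Finset.card_insert_of_notMem hjS]
      push_cast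
      linarith [show (Module.finrank ℝ (K j ⊔ ⨆ i ∈ S, K i : Submodule ℝ E) : ℤ) +
        Module.finrank ℝ (K j ⊓ ⨆ i ∈ S, K i : Submodule ℝ E) =
        Module.finrank ℝ (K j) + Module.finrank ℝ (⨆ i ∈ S, K i : Submodule ℝ E) by
          exact_mod_cast hdim, show (1 : ℤ) ≤
        Module.finrank ℝ (K j ⊓ ⨆ i ∈ S, K i : Submodule ℝ E) by exact_mod_cast hpos]
  have hJpos := hJ.card_pos
  obtain ⟨S, hSJ, hcard, hle⟩ := key (J.card - 1) (by omega)
  obtain rfl := Finset.eq_of_subset_of_card_le hSJ (by omega)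
  linarith

end SwitchedSystem

/-! ### From the four conditions to a splitting of the kernels -/

theorem mainTheorem5 {d p : ℕ}
    (f : Fin p → SwitchedSystem.State d → SwitchedSystem.State d)
    (V : SwitchedSystem.State d → ℝ)
    (h : SwitchedSystem.HasWeakLyapunov f V)
    (J : Finset (Fin p)) (hJ : J.Nonempty)
    (hK : ⨅ i ∈ J, h.kerHess i = ⊥)
    (hcond :
      (∃ i ∈ J, Module.finrank ℝ (h.kerHess i) = 0) ∨
      (∃ i ∈ J, Module.finrank ℝ (h.kerHess i) = 1 ∧
        ∀ j ∈ J, h.kerHess i ≤ h.kerHess j → h.kerHess i = h.kerHess j) ∨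
      J.card = 2 ∨
      (2 < J.card ∧
        (Module.finrank ℝ (⨆ i ∈ J, h.kerHess i : Submodule ℝ (SwitchedSystem.State d)) : ℤ) >
          (∑ i ∈ J, (Module.finrank ℝ (h.kerHess i) : ℤ)) - (J.card : ℤ) + 1)) :
    SwitchedSystem.AsymptoticallyStableFor f
      {u | SwitchedSystem.infiniteIndices u = (J : Set (Fin p))} := by
  classical
  refine ⟨h.uniformlyStable, ?_⟩
  suffices hsep : (∃ i ∈ J, h.kerHess i = ⊥) ∨ ∃ C ⊆ J, C.Nonempty ∧ (∃ j ∈ J, j ∉ C) ∧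
      ∀ i ∈ C, ∀ j ∈ J, j ∉ C → h.kerHess i ⊓ h.kerHess j = ⊥ by
    rcases hsep with ⟨i, hi, hbot⟩ | ⟨C, hCJ, hC, ⟨j, hj, hjC⟩, hsep⟩
    · obtain ⟨δ, hδ, H⟩ := h.locallyAttractiveFor_of_kerHess_eq_bot hbot
      exact ⟨δ, hδ, fun x hx u hu => H x hx u (hu.symm ▸ hi : i ∈ SwitchedSystem.infiniteIndices u)⟩
    · have H := h.locallyAttractiveFor_of_separated hC (D := J \ C)
        ⟨j, Finset.mem_sdiff.2 ⟨hj, hjC⟩⟩ fun i hi k hk =>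
          hsep i hi k (Finset.mem_sdiff.1 hk).1 (Finset.mem_sdiff.1 hk).2
      rwa [← Finset.coe_union, Finset.union_sdiff_of_subset hCJ] at H
  rcases hcond with ⟨i, hi, h0⟩ | ⟨i, hi, h1, hle⟩ | h2 | ⟨-, hgt⟩
  · exact Or.inl ⟨i, hi, Submodule.finrank_eq_zero.1 h0⟩
  · have hatom : IsAtom (h.kerHess i) := Submodule.isAtom_iff_finrank_eq_one.2 h1
    -- `C` collects the indices whose kernel is the line `K_i`. It is not all of `J`, since the
    -- kernels have zero intersection. For `j ∉ C`, the line meets `K_j` in `0`, as otherwise `K_i ≤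
    -- K_j` and the hypothesis puts `j` in `C`.
    refine Or.inr ⟨J.filter fun j => h.kerHess j = h.kerHess i, Finset.filter_subset _ _,
      ⟨i, by simp [hi]⟩, ?_, fun k hk j hj hjC => ?_⟩
    · by_contra! hall
      refine hatom.1 (eq_bot_iff.2 (le_trans (le_iInf₂ fun j hj => ?_) hK.le))
      exact (Finset.mem_filter.1 (hall j hj)).2.ge
    · rw [(Finset.mem_filter.1 hk).2]
      refine (hatom.le_iff.1 inf_le_left).resolve_right fun heq => hjC ?_
      exact Finset.mem_filter.2 ⟨hj, (hle j hj (inf_eq_left.1 heq)).symm⟩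
  · obtain ⟨i, j, hij, rfl⟩ := Finset.card_eq_two.1 h2
    refine Or.inr ⟨{i}, by simp, by simp, ⟨j, by simp, by simpa using hij.symm⟩,
      fun k hk l hl hl' => ?_⟩
    obtain rfl := Finset.mem_singleton.1 hk
    obtain rfl : l = j := by simpa [show l ≠ k by simpa using hl'] using hl
    rwa [Finset.iInf_insert, Finset.iInf_singleton] at hK
  · exact Or.inr (SwitchedSystem.exists_separated_of_finrank_iSup_gt _ hJ hgt)
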